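/- Let $k\ge 1$ be an integer and let $T$ be a finite tree of order $n$. Write $d(v)$ for the degree of a vertex $v$ of $T$, and put $$\Pi_1(T)=\prod_{v\in V(T)}d(v)^2,\qquad \Pi_2(T)=\prod_{uv\in E(T)}d(u)\,d(v).$$ Let $\gamma_k=\gamma_k(T)$ be the distance $k$-domination number of $T$, i.e. the minimum cardinality of a set $D\subseteq V(T)$ such that every vertex outside $D$ is at distance at most $k$ from some vertex of $D$. For integers $s\ge 1$ and $n\ge (k+1)s$, let $T_{n,k,s}$ be the tree on $n$ vertices obtained by attaching to a central vertex one pendent path of length $k$, $s-1$ pendent paths of length $k+1$, and $n-(k+1)s$ pendent edges (the length of a pendent path is the number of its edges, including the edge at the centre); the centre then has degree $n-ks$. Suppose $\gamma_k\ge 3$. Then $n\ge (k+1)\gamma_k$ (so $T_{n,k,\gamma_k}$ is defined), $$\Pi_1(T)\ \ge\ 4^{k\gamma_k-1}(n-k\gamma_k)^2\qquad\text{and}\qquad \Pi_2(T)\ \le\ 4^{k\gamma_k-1}(n-k\gamma_k)^{\,n-k\gamma_k}.$$ Moreover, equality holds in the first inequality if and only if $T\cong T_{n,k,\gamma_k}$,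 and equality holds in the second inequality if and only if $T\cong T_{n,k,\gamma_k}$. -/

import Mathlib

namespace SimpleGraph

/-- The first multiplicative Zagreb index: the product of the squared vertex degrees. -/
def zagrebPiOne {V : Type*} [Fintype V] (G : SimpleGraph V) [DecidableRel G.Adj] : ℕ :=
  ∏ v : V, G.degree v ^ 2

/-- The second multiplicative Zagreb index: the product over all edges `uv` of `d(u) d(v)`. -/
def zagrebPiTwo {V : Type*} [Fintype V] [DecidableEq V] (G : SimpleGraph V)
    [DecidableRel G.Adj] : ℕ :=
  ∏ e ∈ G.edgeFinset, (e.map fun v => G.degree v).mul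

/-- `D` is a distance `k`-dominating set of `G`: every vertex outside `D` is at distance at most
`k` from some vertex of `D`. The extended distance is used, so that vertices in different
components are never within distance `k`. -/
def IsDistDominating {V : Type*} (G : SimpleGraph V) (k : ℕ) (D : Finset V) : Prop :=
  ∀ u : V, u ∉ D → ∃ v ∈ D, G.edist u v ≤ (k : ℕ∞)

/-- The distance `k`-domination number: the minimum cardinality of a distance `k`-dominating set
(the whole vertex set is one, so the minimum is over a nonempty set). -/
noncomputable def distDominationNumber {V : Type*} [Fintype V] (G : SimpleGraph V) (k : ℕ) : ℕ :=
  sInf {m : ℕ | ∃ D : Finset V, G.IsDistDominating k D ∧ D.card = m}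

/-- One orientation of the adjacency in a starlike tree: `none` is the centre and `some ⟨i, j⟩` is
the vertex at distance `j + 1` from the centre on the `i`-th leg. -/
def starlikeRel {ι : Type*} (len : ι → ℕ) :
    Option (Σ i, Fin (len i)) → Option (Σ i, Fin (len i)) → Prop
  | none, some y => y.2.val = 0
  | some x, some y => x.1 = y.1 ∧ x.2.val + 1 = y.2.val
  | _, none => False

/-- The starlike tree obtained by attaching to a centre, for each index `i`, a pendent path of
length `len i`. -/
def starlike {ι : Type*} (len : ι → ℕ) : SimpleGraph (Option (Σ i, Fin (len i))) :=
  SimpleGraph.fromRel (starlikeRel len)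

/-- The lengths of the pendent paths at the centre of `T_{n,k,s}`: one path of length `k`,
`s - 1` paths of length `k + 1`, and `n - (k + 1) s` paths of length `1`. -/
def zagrebLegs (n k s : ℕ) : Fin 1 ⊕ Fin (s - 1) ⊕ Fin (n - (k + 1) * s) → ℕ
  | Sum.inl _ => k
  | Sum.inr (Sum.inl _) => k + 1
  | Sum.inr (Sum.inr _) => 1

/-- The tree `T_{n,k,s}`, meant for `s ≥ 1` and `n ≥ (k + 1) s`: it then has `n` vertices and its
centre has degree `n - k s`. -/
def zagrebTree (n k s : ℕ) : SimpleGraph (Option (Σ i, Fin (zagrebLegs n k s i))) :=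
  starlike (zagrebLegs n k s)

end SimpleGraph

namespace SimpleGraph

/-! ### Distance domination in connected graphs. -/

section Domination

variable {V : Type*} {G : SimpleGraph V}

/-! After taking logarithms, both indices become sums of `ψ (d v)` over the vertices, with the
strictly convex weights `-log d` and `d * log d`, both zero at 1, so leaves contribute nothing. If
`m` vertices are not leaves, their degrees exceed 2 by `n - m - 2` in total. By convexity the sum is
largest when one vertex carries all of this excess, giving `(m - 1) ψ(2) + ψ(n - m)`, and this grows
as `m` shrinks (`IsTree.sum_degree_le`).

Hence it suffices that `m ≥ kγ`. The non-leaves induce a connected graph, and every leaf is adjacent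
to it, so its distance `(k - 1)`-domination number is at least `γ`. The bound `(j + 1) γ_j ≤ order`
with `j = k - 1` finishes; with `j = k` on `T` it gives `(k + 1)γ ≤ n`.

Equality forces `m = kγ` and a single vertex of degree at least 3, so `T` is starlike
(`IsTree.exists_iso_starlike`), and `γ` then pins down the leg lengths
(`starlike_legs_of_distDominationNumber_eq`). The converse only compares degrees.

Discrete intermediate values: the distance to `r` changes by at most one along each edge of a walk.
-/

theorem Walk.exists_dist_eq_and_dist_add_dist_le (hG : G.Connected) (r : V) {u v : V}
    (p : G.Walk u v) {i : ℕ} (hu : G.dist r u ≤ i) (hv : i ≤ G.dist r v) :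
    ∃ w, G.dist r w = i ∧ G.dist u w + G.dist w v ≤ p.length := by
  induction p with
  | nil => exact ⟨_, le_antisymm hu hv, by simp⟩
  | @cons u u' v h p ih =>
    rcases hu.eq_or_lt with hu | hu
    · exact ⟨u, hu, by simpa using dist_le (Walk.cons h p)⟩
    · have h1 : G.dist u u' = 1 := dist_eq_one_iff_adj.2 h
      have h2 := hG.dist_triangle (u := r) (v := u) (w := u')
      obtain ⟨w, hw, hle⟩ := ih (by omega) hv
      have h3 := hG.dist_triangle (u := u) (v := u') (w := w)
      exact ⟨w, hw, by rw [Walk.length_cons]; omega⟩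

theorem IsDistDominating.mono {j k : ℕ} (hjk : j ≤ k) {D : Finset V}
    (hD : G.IsDistDominating j D) : G.IsDistDominating k D := fun u hu =>
  let ⟨v, hv, h⟩ := hD u hu
  ⟨v, hv, h.trans (by exact_mod_cast hjk)⟩

theorem Connected.isDistDominating_of_dist_le (hG : G.Connected) {k : ℕ} {D : Finset V}
    (h : ∀ u, ∃ v ∈ D, G.dist u v ≤ k) : G.IsDistDominating k D := fun u _ =>
  let ⟨v, hv, h⟩ := h u
  ⟨v, hv, by rw [← (hG u v).coe_dist_eq_edist]; exact_mod_cast h⟩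

variable [Fintype V]

theorem IsDistDominating.distDominationNumber_le {k : ℕ} {D : Finset V}
    (hD : G.IsDistDominating k D) : G.distDominationNumber k ≤ D.card :=
  Nat.sInf_le ⟨D, hD, rfl⟩

theorem exists_isDistDominating_card_eq (G : SimpleGraph V) (k : ℕ) :
    ∃ D : Finset V, G.IsDistDominating k D ∧ D.card = G.distDominationNumber k :=
  Nat.sInf_mem (s := {m | ∃ D : Finset V, G.IsDistDominating k D ∧ D.card = m})
    ⟨_, Finset.univ, fun u hu => absurd (Finset.mem_univ u) hu, rfl⟩

theorem distDominationNumber_anti (G : SimpleGraph V) {j k : ℕ} (hjk : j ≤ k) :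
    G.distDominationNumber k ≤ G.distDominationNumber j := by
  obtain ⟨D, hD, hc⟩ := G.exists_isDistDominating_card_eq j
  exact hc ▸ (hD.mono hjk).distDominationNumber_le

/-- Sort the vertices by distance from `r` modulo `j + 1`, where `r` is an end of a diametral pair.
If the diameter is at least `j`, every class dominates, and some class has at most the average size.
-/
theorem Connected.mul_distDominationNumber_le_card (hG : G.Connected) {j : ℕ}
    (hj : j + 1 ≤ Fintype.card V) : (j + 1) * G.distDominationNumber j ≤ Fintype.card V := by
  classical
  have := hG.nonempty
  obtain ⟨⟨r, x⟩, -, hmax⟩ := Finset.exists_max_image (Finset.univ : Finset (V × V))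
    (fun p => G.dist p.1 p.2) Finset.univ_nonempty
  replace hmax : ∀ u v, G.dist u v ≤ G.dist r x := fun u v => hmax (u, v) (Finset.mem_univ _)
  rcases lt_or_ge (G.dist r x) j with hlt | hge
  · have : G.IsDistDominating j {r} :=
      hG.isDistDominating_of_dist_le fun u => ⟨r, by simp, (hmax u r).trans hlt.le⟩
    have := this.distDominationNumber_le
    rw [Finset.card_singleton] at this
    nlinarith
  · obtain ⟨i, hi, hcard⟩ := Finset.exists_card_fiber_le_of_card_le_nsmul
      (s := (Finset.univ : Finset V)) (t := Finset.range (j + 1))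
      (f := fun v => G.dist r v % (j + 1)) (b := (Fintype.card V : ℚ) / (j + 1))
      (by simp) (by
        rw [Finset.card_range, Finset.card_univ, nsmul_eq_mul]
        push_cast
        rw [mul_div_cancel₀]
        positivity)
    rw [Finset.mem_range] at hi
    have hdom : G.IsDistDominating j {v | G.dist r v % (j + 1) = i} := by
      refine hG.isDistDominating_of_dist_le fun u => ?_
      simp only [Finset.mem_filter, Finset.mem_univ, true_and]
      -- Below level `i`, a geodesic from `u` to `x` meets that level at some `w`. Maximality of
      -- `dist r x` gives `dist u w ≤ dist r w = i ≤ j`.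
      rcases lt_or_ge (G.dist r u) i with hu | hu
      · obtain ⟨p, hp⟩ := hG.exists_walk_length_eq_dist u x
        obtain ⟨w, hw, hle⟩ := p.exists_dist_eq_and_dist_add_dist_le hG r hu.le (by omega)
        have h1 := hG.dist_triangle (u := r) (v := w) (w := x)
        have h2 := hmax u x
        exact ⟨w, by rw [hw, Nat.mod_eq_of_lt hi], by omega⟩
      · obtain ⟨p, hp⟩ := hG.exists_walk_length_eq_dist r u
        have hmod := Nat.mod_lt (G.dist r u - i) (Nat.succ_pos j)
        have hdm := Nat.div_add_mod (G.dist r u - i) (j + 1)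
        obtain ⟨w, hw, hle⟩ := p.exists_dist_eq_and_dist_add_dist_le hG r
          (i := i + (j + 1) * ((G.dist r u - i) / (j + 1))) (by simp) (by omega)
        refine ⟨w, by rw [hw, Nat.add_mul_mod_self_left, Nat.mod_eq_of_lt hi], ?_⟩
        rw [dist_comm]
        simp only [Nat.succ_eq_add_one] at hmod
        omega
    have h1 : (G.distDominationNumber j : ℚ) ≤ (Fintype.card V : ℚ) / (j + 1) :=
      le_trans (by exact_mod_cast hdom.distDominationNumber_le) hcard
    rw [le_div_iff₀ (by positivity)] at h1
    rw [mul_comm]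
    exact_mod_cast h1

/-- The size condition is automatic here: if `n ≤ j`, then `γ_j ≤ γ_{n-1} ≤ 1`. -/
theorem Connected.mul_distDominationNumber_le_card_of_two_le (hG : G.Connected) {j : ℕ}
    (h2 : 2 ≤ G.distDominationNumber j) :
    (j + 1) * G.distDominationNumber j ≤ Fintype.card V := by
  have := hG.nonempty
  by_cases hj : j + 1 ≤ Fintype.card V
  · exact hG.mul_distDominationNumber_le_card hj
  · have hpos : 0 < Fintype.card V := Fintype.card_pos
    have h := hG.mul_distDominationNumber_le_card (j := Fintype.card V - 1) (by omega)
    have hanti := G.distDominationNumber_anti (show Fintype.card V - 1 ≤ j by omega)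
    rw [Nat.sub_add_cancel hpos] at h
    nlinarith

theorem distDominationNumber_le_card (G : SimpleGraph V) (k : ℕ) :
    G.distDominationNumber k ≤ Fintype.card V := by
  have : G.IsDistDominating k Finset.univ := fun u hu => absurd (Finset.mem_univ u) hu
  simpa using this.distDominationNumber_le

theorem Iso.distDominationNumber_le {W : Type*} [Fintype W] {H : SimpleGraph W} (e : G ≃g H)
    (k : ℕ) : H.distDominationNumber k ≤ G.distDominationNumber k := by
  obtain ⟨D, hD, hc⟩ := G.exists_isDistDominating_card_eq k
  rw [← hc, ← Finset.card_map e.toEquiv.toEmbedding]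
  refine IsDistDominating.distDominationNumber_le fun u hu => ?_
  obtain ⟨v, hv, hle⟩ := hD (e.symm u) fun h => hu (by
    simpa using Finset.mem_map_of_mem e.toEquiv.toEmbedding h)
  refine ⟨e v, Finset.mem_map_of_mem e.toEquiv.toEmbedding hv, ?_⟩
  obtain ⟨p, hp⟩ := exists_walk_of_edist_ne_top (ne_top_of_le_ne_top (ENat.natCast_ne_top k) hle)
  rw [← hp] at hle
  refine le_trans ?_ hle
  have := edist_le (p.map e.toHom)
  simpa using this

theorem Iso.distDominationNumber_eq {W : Type*} [Fintype W] {H : SimpleGraph W} (e : G ≃g H)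
    (k : ℕ) : G.distDominationNumber k = H.distDominationNumber k :=
  le_antisymm (e.symm.distDominationNumber_le k) (e.distDominationNumber_le k)

/-- If the vertices outside `s` each have a neighbour in `s`, a distance `j`-dominating set of
the subgraph induced on `s` is distance `(j + 1)`-dominating. -/
theorem distDominationNumber_succ_le_induce {s : Set V} [Fintype s]
    (hs : ∀ v ∉ s, ∃ w ∈ s, G.Adj v w) (j : ℕ) :
    G.distDominationNumber (j + 1) ≤ (G.induce s).distDominationNumber j := by
  obtain ⟨D, hD, hc⟩ := (G.induce s).exists_isDistDominating_card_eq j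
  rw [← hc, ← Finset.card_map (Function.Embedding.subtype (· ∈ s))]
  refine IsDistDominating.distDominationNumber_le fun u _ => ?_
  have key : ∀ w : s, ∃ v ∈ D, G.edist w v ≤ j := fun w => by
    by_cases hw : w ∈ D
    · exact ⟨w, hw, by simp⟩
    · obtain ⟨v, hv, hle⟩ := hD w hw
      refine ⟨v, hv, ?_⟩
      obtain ⟨p, hp⟩ := exists_walk_of_edist_ne_top (ne_top_of_le_ne_top (ENat.natCast_ne_top j) hle)
      rw [← hp] at hle
      refine le_trans ?_ hle
      exact (edist_le (p.map (Embedding.induce s).toHom)).trans_eq (by rw [Walk.length_map])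
  have hmem : ∀ v ∈ D, (v : V) ∈ D.map (Function.Embedding.subtype (· ∈ s)) := fun v hv =>
    Finset.mem_map_of_mem (Function.Embedding.subtype (· ∈ s)) hv
  by_cases hu : u ∈ s
  · obtain ⟨v, hv, hle⟩ := key ⟨u, hu⟩
    exact ⟨v, hmem v hv, hle.trans (by exact_mod_cast Nat.le_succ j)⟩
  · obtain ⟨w, hw, hadj⟩ := hs u hu
    obtain ⟨v, hv, hle⟩ := key ⟨w, hw⟩
    refine ⟨v, hmem v hv, (G.edist_triangle (v := w)).trans ?_⟩
    rw [edist_eq_one_iff_adj.2 hadj, add_comm]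
    push_cast
    gcongr

end Domination

end SimpleGraph

/-! ### Discrete convexity inequalities. -/

/-- A strict form of convexity for functions on the positive integers. -/
def StrictlySpreading (ψ : ℕ → ℝ) : Prop :=
  ∀ a b c : ℕ, 0 < a → 0 < b → 0 < c → ψ (a + c) + ψ (b + c) < ψ (a + b + c) + ψ c

namespace StrictlySpreading

/-- The points `a + c` and `b + c` are convex combinations of `c` and `a + b + c` with swapped
weights; the two inequalities are added. -/
theorem of_strictConvexOn {f : ℝ → ℝ} (hf : StrictConvexOn ℝ (Set.Ioi 0) f) :
    StrictlySpreading fun d => f d := by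
  intro a b c ha hb hc
  have ha' : (0 : ℝ) < a := by exact_mod_cast ha
  have hb' : (0 : ℝ) < b := by exact_mod_cast hb
  have hc' : (0 : ℝ) < c := by exact_mod_cast hc
  have hab : (0 : ℝ) < a + b := by positivity
  have hx : (c : ℝ) ∈ Set.Ioi (0 : ℝ) := hc'
  have hy : (a + b + c : ℝ) ∈ Set.Ioi (0 : ℝ) := by simp only [Set.mem_Ioi]; positivity
  have hne : (c : ℝ) ≠ a + b + c := by linarith
  have h1 := hf.2 hx hy hne (div_pos hb' hab) (div_pos ha' hab) (by field_simp; ring)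
  have h2 := hf.2 hx hy hne (div_pos ha' hab) (div_pos hb' hab) (by field_simp)
  simp only [smul_eq_mul] at h1 h2
  rw [show (b / (a + b) * c + a / (a + b) * (a + b + c) : ℝ) = a + c by field_simp; ring] at h1
  rw [show (a / (a + b) * c + b / (a + b) * (a + b + c) : ℝ) = b + c by field_simp; ring] at h2
  have h3 : (b / (a + b) * f c + a / (a + b) * f (a + b + c) : ℝ)
      + (a / (a + b) * f c + b / (a + b) * f (a + b + c)) = f (a + b + c) + f c := by
    field_simp; ring
  push_cast
  linarith

variable {ψ : ℕ → ℝ} (hψ : StrictlySpreading ψ)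
include hψ

theorem le {a b c : ℕ} (hc : 0 < c) : ψ (a + c) + ψ (b + c) ≤ ψ (a + b + c) + ψ c := by
  rcases Nat.eq_zero_or_pos a with rfl | ha
  · simp [add_comm]
  rcases Nat.eq_zero_or_pos b with rfl | hb
  · simp
  exact (hψ a b c ha hb hc).le

/-- Merging two excesses over 2 into one only increases the sum, strictly if both are positive. The
extra `ψ 2` avoids `S.card - 1` and covers the empty set. -/
theorem sum_add_two_le {V : Type*} (x : V → ℕ) (S : Finset V) :
    ∑ v ∈ S, ψ (x v + 2) + ψ 2 ≤ S.card * ψ 2 + ψ (∑ v ∈ S, x v + 2) ∧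
    (∑ v ∈ S, ψ (x v + 2) + ψ 2 = S.card * ψ 2 + ψ (∑ v ∈ S, x v + 2) →
      ∀ u ∈ S, ∀ v ∈ S, u ≠ v → x u = 0 ∨ x v = 0) := by
  classical
  induction S using Finset.induction_on with
  | empty => simp
  | insert a S ha ih =>
    rw [Finset.sum_insert ha, Finset.sum_insert ha, Finset.card_insert_of_notMem ha]
    push_cast
    have hle := hψ.le (a := x a) (b := ∑ v ∈ S, x v) (c := 2) (by norm_num)
    refine ⟨by linarith [ih.1], fun heq => ?_⟩
    have hS := ih.2 (by linarith [ih.1])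
    have hzero : x a = 0 ∨ ∑ v ∈ S, x v = 0 := by
      by_contra! h
      have := hψ (x a) (∑ v ∈ S, x v) 2 (by omega) (by omega) (by norm_num)
      linarith [ih.1]
    rw [Finset.sum_eq_zero_iff] at hzero
    intro u hu v hv huv
    rw [Finset.mem_insert] at hu hv
    rcases hu with rfl | hu <;> rcases hv with rfl | hv
    · exact absurd rfl huv
    · exact hzero.imp_right fun h => h v hv
    · exact (hzero.imp_right fun h => h u hu).symm
    · exact hS u hu v hv huv

/-- Turning one degree 2 into a leaf and raising the large degree by one is a strict gain: `ψ 2 + ψ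
l < ψ (l + 1) + ψ 1`. -/
theorem add_mul_two_lt (p : ℕ) {q : ℕ} (hq : 0 < q) (h1 : ψ 1 = 0) (l : ℕ) (hl : 2 ≤ l) :
    (p + q : ℕ) * ψ 2 + ψ l < p * ψ 2 + ψ (l + q) := by
  induction q, hq using Nat.le_induction with
  | base =>
    have := hψ 1 (l - 1) 1 one_pos (by omega) one_pos
    rw [show 1 + (l - 1) + 1 = l + 1 by omega, show l - 1 + 1 = l by omega] at this
    push_cast
    linarith
  | succ q hq ih =>
    have := hψ 1 (l + q - 1) 1 one_pos (by omega) one_pos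
    rw [show 1 + (l + q - 1) + 1 = l + (q + 1) by omega,
      show l + q - 1 + 1 = l + q by omega] at this
    push_cast at ih ⊢
    linarith

end StrictlySpreading

/-! ### Degree sums of trees and the number of non-leaves. -/

namespace SimpleGraph

section Degrees

variable {V : Type*} [Fintype V] {T : SimpleGraph V} [DecidableRel T.Adj]

theorem IsTree.sum_degree_add_two (hT : T.IsTree) :
    ∑ v, T.degree v + 2 = 2 * Fintype.card V := by
  classical
  have := hT.card_edgeFinset
  have := T.sum_degrees_eq_twice_card_edges
  omega

/-- The vertices that are not leaves. -/
def nonLeaves (T : SimpleGraph V) [DecidableRel T.Adj] : Finset V := {v | 2 ≤ T.degree v}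

@[simp]
theorem mem_nonLeaves {v : V} : v ∈ T.nonLeaves ↔ 2 ≤ T.degree v := by simp [nonLeaves]

theorem Connected.one_le_degree (hT : T.Connected) (h : 2 ≤ Fintype.card V) (v : V) :
    1 ≤ T.degree v := by
  have : Nontrivial V := Fintype.one_lt_card_iff_nontrivial.1 h
  exact hT.preconnected.degree_pos_of_nontrivial v

theorem Connected.degree_eq_one_of_notMem (hT : T.Connected) (h : 2 ≤ Fintype.card V) {v : V}
    (hv : v ∉ T.nonLeaves) : T.degree v = 1 := by
  have := hT.one_le_degree h v
  rw [mem_nonLeaves] at hv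
  omega

theorem Connected.sum_degree_eq {M : Type*} [AddCommMonoid M] [DecidableEq V]
    (hT : T.Connected) (h : 2 ≤ Fintype.card V) (ψ : ℕ → M) :
    ∑ v, ψ (T.degree v) = ∑ v ∈ T.nonLeaves, ψ (T.degree v)
      + (Fintype.card V - T.nonLeaves.card) • ψ 1 := by
  rw [← Finset.sum_add_sum_compl T.nonLeaves, ← Finset.card_compl, ← Finset.sum_const]
  congr 1
  exact Finset.sum_congr rfl fun v hv => by
    rw [hT.degree_eq_one_of_notMem h (Finset.mem_compl.1 hv)]

theorem IsTree.sum_degree_sub_two (hT : T.IsTree) (h : 2 ≤ Fintype.card V) :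
    T.nonLeaves.card + 2 + ∑ v ∈ T.nonLeaves, (T.degree v - 2) = Fintype.card V := by
  classical
  have h1 := hT.sum_degree_add_two
  have h2 := hT.connected.sum_degree_eq h (fun d => d)
  have h3 : ∑ v ∈ T.nonLeaves, T.degree v
      = ∑ v ∈ T.nonLeaves, (T.degree v - 2) + T.nonLeaves.card * 2 := by
    rw [← smul_eq_mul, ← Finset.sum_const, ← Finset.sum_add_distrib]
    exact Finset.sum_congr rfl fun v hv => by rw [mem_nonLeaves] at hv; omega
  have h4 := T.nonLeaves.card_le_univ
  simp only [smul_eq_mul, mul_one] at h2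
  omega

/-- Removing the leaves costs one unit of radius, so the order bound for radius `k - 1` applies to
the remaining connected graph. -/
theorem IsTree.mul_distDominationNumber_le_card_nonLeaves (hT : T.IsTree) {k : ℕ} (hk : 1 ≤ k)
    (h3 : 3 ≤ T.distDominationNumber k) :
    k * T.distDominationNumber k ≤ T.nonLeaves.card := by
  classical
  have hcard := h3.trans (T.distDominationNumber_le_card k)
  obtain ⟨j, rfl⟩ : ∃ j, k = j + 1 := ⟨k - 1, by omega⟩
  have hsum := hT.sum_degree_sub_two (by omega)
  let s : Set V := {v | v ∈ T.nonLeaves}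
  have hpre : (T.induce s).Preconnected := by
    refine hT.connected.preconnected.induce_of_degree_eq_one fun v hv => ?_
    have hd := hT.connected.degree_eq_one_of_notMem (by omega) hv
    rw [← card_neighborSet_eq_degree, Fintype.card_eq_one_iff] at hd
    obtain ⟨w, hw⟩ := hd
    intro a ha b hb
    exact congrArg Subtype.val ((hw ⟨a, ha⟩).trans (hw ⟨b, hb⟩).symm)
  have hne : Nonempty s := by
    by_contra hempty
    have : T.nonLeaves = ∅ := by
      rw [Finset.eq_empty_iff_forall_notMem]
      exact fun v hv => hempty ⟨v, hv⟩
    simp [this] at hsum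
    omega
  have hnbr : ∀ v ∉ s, ∃ w ∈ s, T.Adj v w := by
    intro v hv
    have hd := hT.connected.degree_eq_one_of_notMem (by omega) hv
    obtain ⟨w, hw⟩ := (T.degree_pos_iff_exists_adj v).1 (by omega)
    refine ⟨w, by_contra fun hw' => ?_, hw⟩
    have hd' := hT.connected.degree_eq_one_of_notMem (by omega) hw'
    -- Two adjacent leaves would be the whole tree, and one of them would dominate it alone.
    have huniv : ∀ x, T.dist v x ≤ 1 := by
      have hstep : ∀ {a b : V} (p : T.Walk a b), a = v ∨ a = w → b = v ∨ b = w := by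
        intro a b p
        induction p with
        | nil => exact id
        | @cons a c b hac p ih =>
          rw [degree, Finset.card_eq_one] at hd hd'
          obtain ⟨x, hx⟩ := hd
          obtain ⟨y, hy⟩ := hd'
          have hw1 : w = x := by simpa [hx] using (T.mem_neighborFinset v w).2 hw
          have hv1 : v = y := by simpa [hy] using (T.mem_neighborFinset w v).2 hw.symm
          rintro (rfl | rfl)
          · have : c = x := by simpa [hx] using (T.mem_neighborFinset _ c).2 hac
            exact ih (.inr (this.trans hw1.symm))
          · have : c = y := by simpa [hy] using (T.mem_neighborFinset _ c).2 hac
            exact ih (.inl (this.trans hv1.symm))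
      intro x
      obtain ⟨p⟩ := hT.connected.preconnected v x
      rcases hstep p (.inl rfl) with rfl | rfl
      · simp
      · exact (dist_eq_one_iff_adj.2 hw).le
    have hdom : T.IsDistDominating (j + 1) {v} :=
      hT.connected.isDistDominating_of_dist_le fun u =>
        ⟨v, by simp, by rw [dist_comm]; exact (huniv u).trans (by omega)⟩
    have := hdom.distDominationNumber_le
    rw [Finset.card_singleton] at this
    omega
  have hle := T.distDominationNumber_succ_le_induce hnbr j
  have hmain := (Connected.mk hpre).mul_distDominationNumber_le_card_of_two_le (j := j) (by omega)
  have hs : Fintype.card s = T.nonLeaves.card := Fintype.card_coe _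
  rw [hs] at hmain
  nlinarith

/-- The main estimate for a degree-based index with a strictly convex weight. -/
theorem IsTree.sum_degree_le (hT : T.IsTree) {ψ : ℕ → ℝ} (hψ : StrictlySpreading ψ)
    (h1 : ψ 1 = 0) {s : ℕ} (hs : 1 ≤ s) (hsm : s ≤ T.nonLeaves.card) :
    ∑ v, ψ (T.degree v) ≤ (s - 1 : ℕ) * ψ 2 + ψ (Fintype.card V - s) ∧
    (∑ v, ψ (T.degree v) = (s - 1 : ℕ) * ψ 2 + ψ (Fintype.card V - s) →
      T.nonLeaves.card = s ∧ ∀ u v, 3 ≤ T.degree u → 3 ≤ T.degree v → u = v) := by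
  classical
  have hcard : 2 ≤ Fintype.card V := by
    obtain ⟨v, hv⟩ := Finset.card_pos.1 (hs.trans hsm)
    rw [mem_nonLeaves] at hv
    have := T.degree_lt_card_verts v
    omega
  have hsum := hT.sum_degree_sub_two hcard
  set m := T.nonLeaves.card
  obtain ⟨hle, heq⟩ := hψ.sum_add_two_le (fun v => T.degree v - 2) T.nonLeaves
  have hS : ∑ v ∈ T.nonLeaves, ψ (T.degree v - 2 + 2) = ∑ v, ψ (T.degree v) := by
    rw [hT.connected.sum_degree_eq hcard, h1, smul_zero, add_zero]
    exact Finset.sum_congr rfl fun v hv => by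
      rw [mem_nonLeaves] at hv; rw [Nat.sub_add_cancel hv]
  rw [hS, show ∑ v ∈ T.nonLeaves, (T.degree v - 2) + 2 = Fintype.card V - m by omega] at hle heq
  obtain ⟨p, rfl⟩ : ∃ p, s = p + 1 := ⟨s - 1, by omega⟩
  rw [Nat.add_sub_cancel]
  rcases hsm.eq_or_lt with hsm | hsm
  · have hm : (m : ℝ) = p + 1 := by rw [← hsm]; push_cast; ring
    rw [hm, ← hsm] at hle heq
    refine ⟨by linarith, fun h => ⟨hsm.symm, fun u v hu hv => ?_⟩⟩
    by_contra huv
    have := heq (by linarith) u (by simp; omega) v (by simp; omega) huv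
    omega
  · have hlt := hψ.add_mul_two_lt p (q := m - (p + 1)) (by omega) h1 (Fintype.card V - m)
      (by omega)
    rw [show Fintype.card V - m + (m - (p + 1)) = Fintype.card V - (p + 1) by omega] at hlt
    have hm : (m : ℝ) = ((p + (m - (p + 1)) : ℕ) : ℝ) + 1 := by
      exact_mod_cast (show m = p + (m - (p + 1)) + 1 by omega)
    rw [hm] at hle
    have : ∑ v, ψ (T.degree v) < p * ψ 2 + ψ (Fintype.card V - (p + 1)) := by linarith
    exact ⟨this.le, fun h => absurd h this.ne⟩

end Degrees

end SimpleGraph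

/-! ### Starlike trees: recognition by degrees. -/

namespace SimpleGraph

theorem starlike_adj {ι : Type*} {len : ι → ℕ} {x y : Option (Σ i, Fin (len i))} :
    (starlike len).Adj x y ↔ starlikeRel len x y ∨ starlikeRel len y x := by
  rw [starlike, fromRel_adj, and_iff_right_iff_imp]
  rintro h rfl
  rcases x with _ | x <;> simp [starlikeRel] at h

/-- Reindexing the legs of a starlike tree. -/
def starlikeCongr {ι κ : Type*} {len : ι → ℕ} {len' : κ → ℕ} (e : ι ≃ κ)
    (h : ∀ i, len i = len' (e i)) : starlike len ≃g starlike len' where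
  toEquiv := Equiv.optionCongr (Equiv.sigmaCongr e fun i => finCongr (h i))
  map_rel_iff' := by
    have key : ∀ x : Σ i, Fin (len i), Equiv.sigmaCongr e (fun i => finCongr (h i)) x
        = (⟨e x.1, finCongr (h x.1) x.2⟩ : Σ i, Fin (len' i)) := fun _ => rfl
    rintro (_ | x) (_ | y) <;> simp [starlike_adj, starlikeRel, key]

section Rooted

variable {V : Type*} {T : SimpleGraph V}

theorem IsTree.eq_of_adj_of_dist_add_one (hT : T.IsTree) {c v w w' : V} (h : T.Adj v w)
    (hw : T.dist c w + 1 = T.dist c v) (h' : T.Adj v w') (hw' : T.dist c w' + 1 = T.dist c v) :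
    w = w' := by
  obtain ⟨p, hp⟩ := hT.connected.exists_walk_length_eq_dist c w
  obtain ⟨q, hq⟩ := hT.connected.exists_walk_length_eq_dist c w'
  have hp' := (p.concat h.symm).isPath_of_length_eq_dist (by rw [Walk.length_concat]; omega)
  have hq' := (q.concat h'.symm).isPath_of_length_eq_dist (by rw [Walk.length_concat]; omega)
  have := congrArg (fun r : T.Path c v => r.1.penultimate)
    ((hT.isAcyclic.subsingleton_path c v).elim ⟨_, hp'⟩ ⟨_, hq'⟩)
  simpa using this

theorem Connected.exists_adj_dist_add_one (hT : T.Connected) {c v : V} (hv : v ≠ c) :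
    ∃ w, T.Adj v w ∧ T.dist c w + 1 = T.dist c v := by
  obtain ⟨p, hp⟩ := hT.exists_walk_length_eq_dist v c
  cases p with
  | nil => exact absurd rfl hv
  | @cons _ w _ h p =>
    refine ⟨w, h, ?_⟩
    have h1 := dist_le p
    have h2 := hT.dist_triangle (u := v) (v := w) (w := c)
    rw [dist_eq_one_iff_adj.2 h] at h2
    rw [Walk.length_cons] at hp
    rw [dist_comm (v := w), dist_comm (v := v)]
    omega

/-- A tree in which all vertices but `c` have degree at most two is starlike with centre `c`. -/
theorem IsTree.exists_iso_starlike [Fintype V] [DecidableRel T.Adj] (hT : T.IsTree) (c : V)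
    (hdeg : ∀ v, v ≠ c → T.degree v ≤ 2) :
    ∃ len : T.neighborSet c → ℕ, (∀ i, 1 ≤ len i) ∧ Nonempty (T ≃g starlike len) := by
  classical
  have hex : ∀ v, ∃ w, v ≠ c → T.Adj v w ∧ T.dist c w + 1 = T.dist c v := fun v => by
    by_cases hv : v = c
    · exact ⟨v, fun h => absurd hv h⟩
    · obtain ⟨w, hw⟩ := hT.connected.exists_adj_dist_add_one hv
      exact ⟨w, fun _ => hw⟩
  -- `p` is the parent map towards the root `c`; its value at `c` is arbitrary.
  choose p hp using hex
  have hp_uniq : ∀ {v w}, T.Adj v w → T.dist c w + 1 = T.dist c v → w = p v := by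
    intro v w h hd
    have hv : v ≠ c := by rintro rfl; simp at hd
    exact hT.eq_of_adj_of_dist_add_one h hd (hp v hv).1 (hp v hv).2
  have hpos : ∀ {v}, v ≠ c → 0 < T.dist c v := fun hv => hT.connected.pos_dist_of_ne hv.symm
  have hzero : ∀ {v}, T.dist c v = 0 ↔ v = c := fun {v} => by
    rw [hT.connected.dist_eq_zero_iff, eq_comm]
  -- A vertex other than `c` has its own parent among at most two neighbours, which leaves room for
  -- one child.
  have hchild : ∀ {u v}, u ≠ c → v ≠ c → p u = p v → p u ≠ c → u = v := by
    intro u v hu hv huv hc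
    by_contra hne
    have h1 := hp u hu
    have h2 := hp v hv
    have h3 := hp (p u) hc
    have hsub : ({p (p u), u, v} : Finset V) ⊆ T.neighborFinset (p u) := by
      intro x hx
      simp only [Finset.mem_insert, Finset.mem_singleton] at hx
      rw [mem_neighborFinset]
      rcases hx with rfl | rfl | rfl
      · exact h3.1
      · exact h1.1.symm
      · rw [huv]; exact h2.1.symm
    have hcard : ({p (p u), u, v} : Finset V).card = 3 := by
      rw [Finset.card_eq_three]
      refine ⟨_, _, _, ?_, ?_, hne, rfl⟩
      · intro h
        rw [h] at h3
        omega
      · intro h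
        rw [← huv] at h2
        rw [h] at h3
        omega
    have := Finset.card_le_card hsub
    have := hdeg (p u) hc
    rw [hcard, card_neighborFinset_eq_degree] at *
    omega
  have hiter : ∀ t v, t ≤ T.dist c v → T.dist c (p^[t] v) + t = T.dist c v := by
    intro t
    induction t with
    | zero => simp
    | succ t ih =>
      intro v hv
      have h := ih v (by omega)
      rw [Function.iterate_succ_apply']
      have := (hp (p^[t] v) (fun h' => by rw [hzero.2 h'] at h; omega)).2
      omega
  -- The ancestor of `v` adjacent to `c`. Together with `dist c v` it determines `v`.
  let leg : V → V := fun v => p^[T.dist c v - 1] v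
  have hleg_dist : ∀ {v}, v ≠ c → T.dist c (leg v) = 1 := fun {v} hv => by
    have := hiter (T.dist c v - 1) v (by omega)
    have := hpos hv
    simp only [leg]
    omega
  have hleg_mem : ∀ {v}, v ≠ c → leg v ∈ T.neighborSet c := fun hv =>
    dist_eq_one_iff_adj.1 (hleg_dist hv)
  have hleg_p : ∀ {v}, v ≠ c → p v ≠ c → leg (p v) = leg v := by
    intro v hv hpv
    have h1 := (hp v hv).2
    have h2 := hpos hpv
    simp only [leg]
    rw [← Function.iterate_succ_apply]
    congr 2
    omega
  have hinj : ∀ d u v, T.dist c u = d → T.dist c v = d → u ≠ c → v ≠ c → leg u = leg v →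
      u = v := by
    intro d
    induction d with
    | zero => exact fun u v hu _ hne => absurd (hzero.1 hu) hne
    | succ d ih =>
      intro u v hu hv hne hne' hl
      by_cases hpu : p u = c
      · have h1 := (hp u hne).2
        rw [hpu, dist_self] at h1
        simpa [leg, hu, hv, show d = 0 by omega] using hl
      · have h1 := (hp u hne).2
        have h2 := (hp v hne').2
        have hpv : p v ≠ c := fun h => by
          rw [h, dist_self] at h2
          exact hpu (hzero.1 (by omega))
        exact hchild hne hne' (ih (p u) (p v) (by omega) (by omega) hpu hpv
          (by rw [hleg_p hne hpu, hleg_p hne' hpv, hl])) hpu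
  let fib : V → Finset V := fun i => {v | v ≠ c ∧ leg v = i}
  have hfib : ∀ {v}, v ≠ c → T.dist c v - 1 < (fib (leg v)).card := by
    intro v hv
    have hpos := hpos hv
    suffices T.dist c v ≤ (fib (leg v)).card by omega
    rw [← Finset.card_range (T.dist c v)]
    have hne : ∀ t < T.dist c v, p^[t] v ≠ c := fun t ht h => by
      have := hiter t v ht.le
      rw [h, dist_self] at this
      omega
    refine Finset.card_le_card_of_injOn (fun t => p^[t] v) (fun t ht => ?_) fun s hs t ht hst => ?_
    · simp only [Finset.coe_range, Set.mem_Iio] at ht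
      simp only [fib, Finset.coe_filter, Finset.mem_univ, true_and, Set.mem_ofPred_eq]
      refine ⟨hne t ht, ?_⟩
      have := hiter t v ht.le
      simp only [leg]
      rw [← Function.iterate_add_apply]
      congr 2
      omega
    · simp only [Finset.coe_range, Set.mem_Iio] at hs ht
      have h1 := hiter s v hs.le
      have h2 := hiter t v ht.le
      simp only at hst
      rw [hst] at h1
      omega
  let len : T.neighborSet c → ℕ := fun i => (fib i).card
  let Φ : V → Option (Σ i, Fin (len i)) := fun v =>
    if hv : v = c then none else some ⟨⟨leg v, hleg_mem hv⟩, ⟨T.dist c v - 1, hfib hv⟩⟩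
  have hΦc : Φ c = none := by simp [Φ]
  have hΦ : ∀ {v} (hv : v ≠ c),
      Φ v = some ⟨⟨leg v, hleg_mem hv⟩, ⟨T.dist c v - 1, hfib hv⟩⟩ := fun hv => by
    simp [Φ, hv]
  have hΦ_inj : Function.Injective Φ := by
    intro u v huv
    by_cases hu : u = c <;> by_cases hv : v = c
    · rw [hu, hv]
    · rw [hu, hΦc, hΦ hv] at huv
      simp at huv
    · rw [hv, hΦc, hΦ hu] at huv
      simp at huv
    · rw [hΦ hu, hΦ hv, Option.some_inj] at huv
      have h1 : leg u = leg v := congrArg (fun x : Σ i, Fin (len i) => (x.1 : V)) huv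
      have h2 : T.dist c u - 1 = T.dist c v - 1 :=
        congrArg (fun x : Σ i, Fin (len i) => x.2.val) huv
      have := hpos hu
      have := hpos hv
      exact hinj _ u v rfl (by omega) hu hv h1
  -- Leg lengths are defined as fibre sizes, so both sides have equal cardinality and injectivity of
  -- `Φ` suffices.
  have hcard : Fintype.card V = Fintype.card (Option (Σ i, Fin (len i))) := by
    rw [Fintype.card_option, Fintype.card_sigma]
    simp only [Fintype.card_fin, len]
    have h1 : ((Finset.univ : Finset V).erase c).card = Fintype.card V - 1 := by
      rw [Finset.card_erase_of_mem (Finset.mem_univ c), Finset.card_univ]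
    have h2 := Finset.card_eq_sum_card_fiberwise (f := leg) (s := Finset.univ.erase c)
      (t := T.neighborFinset c) (fun v hv => by
        simp only [Finset.coe_erase, Finset.coe_univ, Set.mem_sdiff, Set.mem_univ,
          Set.mem_singleton_iff, true_and] at hv
        simpa using hleg_mem hv)
    have h3 : ∀ i, (Finset.univ.erase c).filter (fun v => leg v = i) = fib i := fun i => by
      ext v; simp [fib]
    simp only [h3] at h2
    have h4 : ∑ i ∈ T.neighborFinset c, (fib i).card
        = ∑ i : T.neighborSet c, (fib i).card := by
      rw [neighborFinset, ← Finset.sum_coe_sort]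
      exact Fintype.sum_equiv (Equiv.subtypeEquivRight fun x => by simp) _ _ fun x => rfl
    have := Fintype.card_pos_iff.2 ⟨c⟩
    omega
  have hbij : Function.Bijective Φ :=
    (Fintype.bijective_iff_injective_and_card Φ).2 ⟨hΦ_inj, hcard⟩
  have hrel : ∀ u v, starlikeRel len (Φ u) (Φ v) ↔ v ≠ c ∧ p v = u := by
    intro u v
    by_cases hv : v = c
    · subst hv
      rw [hΦc]
      cases Φ u <;> simp [starlikeRel]
    have hdv := (hp v hv).2
    by_cases hu : u = c
    · rw [hu, hΦc, hΦ hv]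
      simp only [starlikeRel, ne_eq, hv, not_false_eq_true, true_and]
      rw [← hzero (v := p v)]
      omega
    · rw [hΦ hv, hΦ hu]
      have hdu := hpos hu
      simp only [starlikeRel, ne_eq, hv, not_false_eq_true, true_and, Subtype.mk.injEq]
      constructor
      · rintro ⟨h1, h2⟩
        have hpv : p v ≠ c := fun h => by rw [h, dist_self] at hdv; omega
        exact hinj _ _ u rfl (by omega) hpv hu ((hleg_p hv hpv).trans h1.symm)
      · rintro rfl
        exact ⟨hleg_p hv hu, by omega⟩
  refine ⟨len, fun i => ?_, ⟨⟨Equiv.ofBijective Φ hbij, fun {u v} => ?_⟩⟩⟩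
  · have hi : T.Adj c i := i.2
    have h1 := dist_eq_one_iff_adj.2 hi
    have : (i : V) ∈ fib i := by simp [fib, leg, h1, hi.ne']
    exact Finset.card_pos.2 ⟨_, this⟩
  · rw [Equiv.ofBijective_apply, Equiv.ofBijective_apply, starlike_adj, hrel, hrel]
    constructor
    · rintro (⟨hv, rfl⟩ | ⟨hu, rfl⟩)
      · exact (hp v hv).1.symm
      · exact (hp u hu).1
    · intro h
      rcases hT.dist_eq_dist_add_one_of_adj c h with hd | hd
      · exact .inr ⟨by rintro rfl; simp at hd, (hp_uniq h hd.symm).symm⟩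
      · exact .inl ⟨by rintro rfl; simp at hd, (hp_uniq h.symm hd.symm).symm⟩

end Rooted

end SimpleGraph

/-! ### Domination in starlike trees and the forced leg lengths. -/

namespace SimpleGraph

section Starlike

variable {ι : Type*} {len : ι → ℕ}

/-- The right-hand side is `|j - j'|` in truncated subtraction. -/
theorem starlike_edist_leg_le {i : ι} (j j' : Fin (len i)) :
    (starlike len).edist (some ⟨i, j⟩) (some ⟨i, j'⟩) ≤ ((j' - j + (j - j') : ℕ) : ℕ∞) := by
  wlog h : j ≤ j' generalizing j j'
  · rw [edist_comm, add_comm]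
    exact this j' j (le_of_not_ge h)
  obtain ⟨j, hj⟩ := j
  obtain ⟨j', hj'⟩ := j'
  rw [Fin.mk_le_mk] at h
  induction j', h using Nat.le_induction with
  | base => simp
  | succ m hm ih =>
    have hadj : (starlike len).Adj (some ⟨i, ⟨m, by omega⟩⟩) (some ⟨i, ⟨m + 1, hj'⟩⟩) :=
      starlike_adj.2 (.inl ⟨rfl, rfl⟩)
    refine (SimpleGraph.edist_triangle (v := some ⟨i, ⟨m, by omega⟩⟩)).trans ?_
    rw [edist_eq_one_iff_adj.2 hadj]
    refine (add_le_add_left (ih (by omega)) 1).trans ?_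
    norm_cast
    simp only
    omega

theorem starlike_edist_none_le {i : ι} (j : Fin (len i)) :
    (starlike len).edist none (some ⟨i, j⟩) ≤ ((j + 1 : ℕ) : ℕ∞) := by
  have hpos : 0 < len i := j.pos
  have hadj : (starlike len).Adj none (some ⟨i, ⟨0, hpos⟩⟩) := starlike_adj.2 (.inl rfl)
  refine (SimpleGraph.edist_triangle (v := some ⟨i, ⟨0, hpos⟩⟩)).trans ?_
  rw [edist_eq_one_iff_adj.2 hadj]
  refine (add_le_add_right (starlike_edist_leg_le _ j) 1).trans ?_
  norm_cast
  simp only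
  omega

theorem starlike_edist_le (i i' : ι) (j : Fin (len i)) (j' : Fin (len i')) :
    (starlike len).edist (some ⟨i, j⟩) (some ⟨i', j'⟩) ≤ ((j + 1 + (j' + 1) : ℕ) : ℕ∞) := by
  refine (SimpleGraph.edist_triangle (v := none)).trans ?_
  rw [edist_comm, Nat.cast_add]
  exact add_le_add (starlike_edist_none_le j) (starlike_edist_none_le j')

variable [Fintype ι]

/-- The centre covers the first `k` vertices of each leg; vertices at distances `2k, 4k, ...` from
it, the last clamped to the end of the leg, cover the rest. -/
theorem starlike_distDominationNumber_le (hlen : ∀ i, 1 ≤ len i) {k : ℕ} (hk : 1 ≤ k) :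
    (starlike len).distDominationNumber k ≤ ∑ i, ((len i - 1) / k + 1) / 2 + 1 := by
  classical
  let c : ι → ℕ := fun i => ((len i - 1) / k + 1) / 2
  let f : (Σ i, Fin (c i)) → Option (Σ i, Fin (len i)) := fun x =>
    some ⟨x.1, ⟨min (2 * k * (x.2 + 1)) (len x.1) - 1, by have := hlen x.1; omega⟩⟩
  have hcard : (insert none (Finset.univ.image f)).card ≤ ∑ i, c i + 1 := by
    refine (Finset.card_insert_le _ _).trans (Nat.succ_le_succ (Finset.card_image_le.trans ?_))
    simp
  refine le_trans (IsDistDominating.distDominationNumber_le ?_) hcard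
  rintro (_ | ⟨i, j⟩) hu
  · simp at hu
  · by_cases hj : j.val + 1 ≤ k
    · refine ⟨none, by simp, ?_⟩
      rw [edist_comm]
      exact (starlike_edist_none_le j).trans (by exact_mod_cast hj)
    · have hji := j.2
      have hk2 : 0 < 2 * k := by omega
      have hdm := Nat.div_add_mod (j.val - k) (2 * k)
      have hmod := Nat.mod_lt (j.val - k) hk2
      have ht : (j.val - k) / (2 * k) < c i := by
        have h1 : c i = (len i - 1 + k) / (2 * k) := by
          simp only [c]
          rw [← Nat.add_div_right _ hk, Nat.div_div_eq_div_mul, mul_comm k 2]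
        rw [h1, Nat.lt_iff_add_one_le, ← Nat.add_div_right _ hk2]
        exact Nat.div_le_div_right (by omega)
      refine ⟨f ⟨i, ⟨_, ht⟩⟩, by simp, (starlike_edist_leg_le _ _).trans ?_⟩
      norm_cast
      simp only
      rw [mul_add, mul_one]
      omega

/-- Distance domination number `s` forces a starlike tree with few inner vertices to have the leg
lengths of `zagrebTree`. -/
theorem starlike_legs_of_distDominationNumber_eq (hlen : ∀ i, 1 ≤ len i) {k s : ℕ} (hk : 1 ≤ k)
    (hs : 3 ≤ s) (hγ : (starlike len).distDominationNumber k = s)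
    (hsum : ∑ i, (len i - 1) = k * s - 1) :
    ∃ (i₀ : ι) (L : Finset ι), i₀ ∉ L ∧ L.card = s - 1 ∧ len i₀ = k ∧
      (∀ i ∈ L, len i = k + 1) ∧ ∀ i, i ∉ L → i ≠ i₀ → len i = 1 := by
  classical
  have hle := starlike_distDominationNumber_le hlen hk
  rw [hγ] at hle
  let q : ι → ℕ := fun i => (len i - 1) / k
  let r : ι → ℕ := fun i => (len i - 1) % k
  have hqr : k * ∑ i, q i + ∑ i, r i = k * s - 1 := by
    rw [← hsum, Finset.mul_sum, ← Finset.sum_add_distrib]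
    exact Finset.sum_congr rfl fun i _ => Nat.div_add_mod _ _
  have hk1 : k ≤ k * s := Nat.le_mul_of_pos_right k (by omega)
  have hq_le : ∑ i, q i ≤ s - 1 := by
    have : k * ∑ i, q i < k * s := by omega
    have := Nat.lt_of_mul_lt_mul_left this
    omega
  have hhalf : ∀ i ∈ Finset.univ, (q i + 1) / 2 ≤ q i := fun i _ => by omega
  have hhalf_le := Finset.sum_le_sum hhalf
  change s ≤ ∑ i, (q i + 1) / 2 + 1 at hle
  -- The chain `s - 1 ≤ ∑ (q i + 1) / 2 ≤ ∑ q i ≤ s - 1` collapses, so every `q i` is 0 or 1.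
  have hq_sum : ∑ i, q i = s - 1 := by omega
  have hq_half := (Finset.sum_eq_sum_iff_of_le hhalf).1 (by omega)
  have hq_one : ∀ i, q i ≤ 1 := fun i => by have := hq_half i (Finset.mem_univ i); omega
  have hr_sum : ∑ i, r i = k - 1 := by
    obtain ⟨s, rfl⟩ : ∃ s', s = s' + 1 := ⟨s - 1, by omega⟩
    rw [hq_sum, Nat.add_sub_cancel, mul_add, mul_one] at hqr
    omega
  let L : Finset ι := {i | q i = 1}
  have hmemL : ∀ {i}, i ∈ L ↔ q i = 1 := by simp [L]
  have hLcard : L.card = s - 1 := by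
    rw [← hq_sum, Finset.card_filter]
    refine Finset.sum_congr rfl fun i _ => ?_
    have := hq_one i
    split_ifs <;> omega
  have hlenL : ∀ {i}, i ∈ L → len i = k + r i + 1 := fun {i} hi => by
    have h1 := Nat.div_add_mod (len i - 1) k
    change k * q i + r i = _ at h1
    rw [hmemL.1 hi] at h1
    have := hlen i
    omega
  have hlenS : ∀ {i}, i ∉ L → len i = r i + 1 := fun {i} hi => by
    have h1 := Nat.div_add_mod (len i - 1) k
    change k * q i + r i = _ at h1
    rw [hmemL] at hi
    have h2 := hq_one i
    rw [show q i = 0 by omega] at h1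
    have := hlen i
    omega
  have hr_lt : ∀ i, r i < k := fun i => Nat.mod_lt _ hk
  -- On a long leg, of length `k + r i + 1`, the vertex at index `r i` is the one closest to the
  -- centre that still covers the whole leg. These `s - 1` vertices cannot dominate, and only a
  -- short leg can be at fault.
  let f : L → Option (Σ i, Fin (len i)) := fun i =>
    some ⟨i, ⟨r i, by rw [hlenL i.2]; omega⟩⟩
  have hnot : ¬ (starlike len).IsDistDominating k (Finset.univ.image f) := fun h => by
    have h1 := h.distDominationNumber_le.trans Finset.card_image_le
    rw [Finset.card_univ, Fintype.card_coe] at h1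
    omega
  obtain ⟨a, ha, b, hb, hab⟩ := Finset.one_lt_card.1 (show 1 < L.card by omega)
  have hfmem : ∀ l : L, f l ∈ Finset.univ.image f := fun l =>
    Finset.mem_image_of_mem f (Finset.mem_univ l)
  obtain ⟨i₀, hi₀, hfar⟩ : ∃ i ∉ L, ∀ l ∈ L, k - 1 ≤ r i + r l := by
    by_contra! hcon
    refine hnot fun u _ => ?_
    rcases u with _ | ⟨i, j⟩
    · refine ⟨_, hfmem ⟨a, ha⟩, (starlike_edist_none_le _).trans ?_⟩
      norm_cast
      exact hr_lt a
    · by_cases hi : i ∈ L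
      · refine ⟨_, hfmem ⟨i, hi⟩, (starlike_edist_leg_le _ _).trans ?_⟩
        norm_cast
        have h1 := j.2
        have h2 := hlenL hi
        have h3 := hr_lt i
        simp only
        omega
      · obtain ⟨l, hl, hlt⟩ := hcon i hi
        refine ⟨_, hfmem ⟨l, hl⟩, (starlike_edist_le _ _ _ _).trans ?_⟩
        norm_cast
        have h1 := j.2
        have h2 := hlenS hi
        simp only
        omega
  have hab₀ : i₀ ∉ ({a, b} : Finset ι) := by
    simp only [Finset.mem_insert, Finset.mem_singleton]
    rintro (rfl | rfl) <;> contradiction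
  -- Since `s ≥ 3` there are two long legs. With the total remainder `k - 1`, `hfar` at `a` makes `r
  -- b` vanish and vice versa, hence `r i₀ = k - 1`.
  have h3 := Finset.sum_le_sum_of_subset (f := r) (Finset.subset_univ {i₀, a, b})
  rw [Finset.sum_insert hab₀, Finset.sum_pair hab] at h3
  have hfa := hfar a ha
  have hfb := hfar b hb
  have hzero : ∀ i, i ≠ i₀ → r i = 0 := fun i hi => by
    have h2 := Finset.sum_le_sum_of_subset (f := r) (Finset.subset_univ {i₀, i})
    rw [Finset.sum_pair hi.symm] at h2
    omega
  refine ⟨i₀, L, hi₀, hLcard, ?_, fun i hi => ?_, fun i hi hne => ?_⟩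
  · rw [hlenS hi₀]
    omega
  · rw [hlenL hi, hzero i (by rintro rfl; contradiction)]
  · rw [hlenS hi, hzero i hne]

theorem nonempty_starlike_iso_zagrebTree {n k s : ℕ} (hs : 1 ≤ s) (hn : (k + 1) * s ≤ n)
    (hι : Fintype.card ι = n - k * s) {i₀ : ι} {L : Finset ι} (hi₀ : i₀ ∉ L)
    (hL : L.card = s - 1) (hk : len i₀ = k) (hlenL : ∀ i ∈ L, len i = k + 1)
    (hone : ∀ i, i ∉ L → i ≠ i₀ → len i = 1) :
    Nonempty (starlike len ≃g zagrebTree n k s) := by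
  classical
  have hR : ((insert i₀ L)ᶜ).card = n - (k + 1) * s := by
    rw [Finset.card_compl, Finset.card_insert_of_notMem hi₀, hL, hι, add_mul, one_mul]
    omega
  let eL := (L.equivFinOfCardEq hL).symm
  let eR := (((insert i₀ L)ᶜ).equivFinOfCardEq hR).symm
  let f : Fin 1 ⊕ Fin (s - 1) ⊕ Fin (n - (k + 1) * s) → ι :=
    Sum.elim (fun _ => i₀) (Sum.elim (fun x => eL x) fun x => eR x)
  have hmemR : ∀ x, (eR x : ι) ≠ i₀ ∧ (eR x : ι) ∉ L := fun x => by
    simpa [not_or] using (eR x).2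
  have hsurj : Function.Surjective f := fun i => by
    by_cases h₀ : i = i₀
    · exact ⟨.inl 0, h₀.symm⟩
    by_cases hi : i ∈ L
    · exact ⟨.inr (.inl (eL.symm ⟨i, hi⟩)), by simp [f]⟩
    · exact ⟨.inr (.inr (eR.symm ⟨i, by simp [h₀, hi]⟩)), by simp [f]⟩
  have hbij : Function.Bijective f := by
    refine (Fintype.bijective_iff_surjective_and_card f).2 ⟨hsurj, ?_⟩
    simp only [Fintype.card_sum, Fintype.card_fin, hι]
    rw [add_mul, one_mul] at hn ⊢
    omega
  refine ⟨(starlikeCongr (Equiv.ofBijective f hbij) fun x => ?_).symm⟩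
  rcases x with x | x | x
  · exact hk.symm
  · exact (hlenL _ (eL x).2).symm
  · exact (hone _ (hmemR x).2 (hmemR x).1).symm

end Starlike

end SimpleGraph

/-! ### Degree sums of the extremal tree and the equality case. -/

namespace SimpleGraph

section StarlikeDegrees

variable {ι : Type*} {len : ι → ℕ} [Fintype ι] [DecidableEq ι]
  [DecidableRel (starlike len).Adj]

theorem starlike_degree_none (hlen : ∀ i, 1 ≤ len i) :
    (starlike len).degree none = Fintype.card ι := by
  let f : ι → Option (Σ i, Fin (len i)) := fun i => some ⟨i, ⟨0, hlen i⟩⟩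
  have hf : Function.Injective f := fun i j h => by
    simp only [f, Option.some_inj] at h
    exact congrArg Sigma.fst h
  have : (starlike len).neighborFinset none = Finset.univ.image f := by
    ext x
    rw [mem_neighborFinset, starlike_adj]
    rcases x with _ | ⟨i, ⟨j, hj⟩⟩
    · simp [starlikeRel, f]
    · simp only [starlikeRel, or_false, Finset.mem_image, Finset.mem_univ, true_and, f,
        Option.some_inj]
      constructor
      · rintro rfl
        exact ⟨i, rfl⟩
      · rintro ⟨i', h⟩
        cases h
        rfl
  rw [degree, this, Finset.card_image_of_injective _ hf, Finset.card_univ]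

theorem starlike_degree_some (i : ι) (j : Fin (len i)) :
    (starlike len).degree (some ⟨i, j⟩) = if j + 1 < len i then 2 else 1 := by
  obtain ⟨j, hj⟩ := j
  let a : Option (Σ i, Fin (len i)) :=
    if j = 0 then none else some ⟨i, ⟨j - 1, by omega⟩⟩
  have ha : ∀ x, x = a ↔ starlikeRel len x (some ⟨i, ⟨j, hj⟩⟩) := by
    rintro (_ | ⟨i', ⟨j', hj'⟩⟩)
    · by_cases h : j = 0 <;> simp [a, h, starlikeRel]
    · by_cases h : j = 0
      · simp [a, h, starlikeRel]
      · simp only [a, h, if_false, Option.some_inj, starlikeRel]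
        constructor
        · intro h'
          cases h'
          exact ⟨rfl, by omega⟩
        · rintro ⟨rfl, h'⟩
          subst h'
          rfl
  simp only
  split_ifs with h
  · let b : Option (Σ i, Fin (len i)) := some ⟨i, ⟨j + 1, h⟩⟩
    have hb : ∀ x, x = b ↔ starlikeRel len (some ⟨i, ⟨j, hj⟩⟩) x := by
      rintro (_ | ⟨i', ⟨j', hj'⟩⟩)
      · simp [b, starlikeRel]
      · simp only [b, Option.some_inj, starlikeRel]
        constructor
        · intro h'
          cases h'
          exact ⟨rfl, rfl⟩
        · rintro ⟨rfl, h'⟩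
          subst h'
          rfl
    rw [degree, Finset.card_eq_two]
    refine ⟨b, a, fun hab => ?_, ?_⟩
    · have := (ha b).1 hab
      simp [b, starlikeRel] at this
      omega
    · ext x
      rw [mem_neighborFinset, starlike_adj, Finset.mem_insert, Finset.mem_singleton, ha, hb]
  · rw [degree, Finset.card_eq_one]
    refine ⟨a, ?_⟩
    ext x
    rw [mem_neighborFinset, starlike_adj, Finset.mem_singleton, ha, or_iff_right]
    rcases x with _ | ⟨i', ⟨j', hj'⟩⟩
    · simp [starlikeRel]
    · rintro ⟨h1, h2⟩
      simp only at h1 h2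
      subst h1
      omega

theorem sum_starlike_degree (hlen : ∀ i, 1 ≤ len i) (ψ : ℕ → ℝ) (h1 : ψ 1 = 0) :
    ∑ x, ψ ((starlike len).degree x)
      = (∑ i, (len i - 1) : ℕ) * ψ 2 + ψ (Fintype.card ι) := by
  rw [Fintype.sum_option, starlike_degree_none hlen, add_comm, Fintype.sum_sigma]
  congr 1
  rw [Nat.cast_sum, Finset.sum_mul]
  refine Finset.sum_congr rfl fun i _ => ?_
  simp only [starlike_degree_some]
  obtain ⟨m, hm⟩ : ∃ m, len i = m + 1 := ⟨len i - 1, by have := hlen i; omega⟩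
  rw [hm, Fin.sum_univ_castSucc]
  simp [h1]

end StarlikeDegrees

theorem one_le_zagrebLegs {n k s : ℕ} (hk : 1 ≤ k)
    (i : Fin 1 ⊕ Fin (s - 1) ⊕ Fin (n - (k + 1) * s)) : 1 ≤ zagrebLegs n k s i := by
  rcases i with i | i | i <;> simp [zagrebLegs, hk]

/-- The extremal tree attains the bound by its degrees alone, so its domination number need not be
computed. -/
theorem sum_zagrebTree_degree {n k s : ℕ} (hk : 1 ≤ k) (hs : 1 ≤ s) (hn : (k + 1) * s ≤ n)
    [hdec : DecidableRel (zagrebTree n k s).Adj] (ψ : ℕ → ℝ) (h1 : ψ 1 = 0) :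
    ∑ x, ψ ((zagrebTree n k s).degree x) = (k * s - 1 : ℕ) * ψ 2 + ψ (n - k * s) := by
  have hsum : ∑ i, (zagrebLegs n k s i - 1) = k * s - 1 := by
    obtain ⟨s, rfl⟩ : ∃ s', s = s' + 1 := ⟨s - 1, by omega⟩
    simp only [Fintype.sum_sum_type, zagrebLegs, Finset.sum_const, Finset.card_univ,
      Fintype.card_fin, smul_eq_mul, Nat.add_sub_cancel, mul_add, mul_one]
    rw [mul_comm s k]
    omega
  have hcard : Fintype.card (Fin 1 ⊕ Fin (s - 1) ⊕ Fin (n - (k + 1) * s)) = n - k * s := by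
    simp only [Fintype.card_sum, Fintype.card_fin]
    rw [add_mul, one_mul] at hn ⊢
    omega
  rw [← hsum, ← hcard]
  exact @sum_starlike_degree _ (zagrebLegs n k s) _ _ hdec (one_le_zagrebLegs hk) ψ h1

section Extremal

variable {V : Type*} [Fintype V] {T : SimpleGraph V} [DecidableRel T.Adj]

theorem IsTree.nonempty_iso_zagrebTree (hT : T.IsTree) {k s : ℕ} (hk : 1 ≤ k) (hs : 3 ≤ s)
    (hγ : T.distDominationNumber k = s) (hcard : T.nonLeaves.card = k * s)
    (huniq : ∀ u v, 3 ≤ T.degree u → 3 ≤ T.degree v → u = v) :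
    Nonempty (T ≃g zagrebTree (Fintype.card V) k s) := by
  classical
  have hn := hT.connected.mul_distDominationNumber_le_card_of_two_le (j := k) (by omega)
  rw [hγ] at hn
  have hn' := hn
  rw [add_mul, one_mul] at hn'
  have hsum := hT.sum_degree_sub_two (by omega)
  -- The total excess is `n - k * s - 2 ≥ s - 2 > 0`.
  obtain ⟨c, hc, hc3⟩ : ∃ c ∈ T.nonLeaves, T.degree c - 2 ≠ 0 := by
    refine Finset.exists_ne_zero_of_sum_ne_zero ?_
    omega
  have hdeg : ∀ v, v ≠ c → T.degree v ≤ 2 := fun v hv => by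
    by_contra h
    exact hv (huniq v c (by omega) (by omega))
  rw [Finset.sum_eq_single_of_mem c hc fun v _ hv => by have := hdeg v hv; omega] at hsum
  obtain ⟨len, hlen, ⟨e⟩⟩ := hT.exists_iso_starlike c hdeg
  have hι : Fintype.card (T.neighborSet c) = Fintype.card V - k * s := by
    rw [card_neighborSet_eq_degree]
    omega
  have hV : Fintype.card V = ∑ i, len i + 1 := by
    rw [Fintype.card_congr e.toEquiv, Fintype.card_option, Fintype.card_sigma]
    simp
  have hlen_sum : ∑ i, (len i - 1) + Fintype.card (T.neighborSet c) = ∑ i, len i := by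
    rw [← Finset.card_univ, Finset.card_eq_sum_ones, ← Finset.sum_add_distrib]
    exact Finset.sum_congr rfl fun i _ => Nat.sub_add_cancel (hlen i)
  obtain ⟨i₀, L, hi₀, hL, h1, h2, h3⟩ := starlike_legs_of_distDominationNumber_eq hlen hk hs
    ((e.distDominationNumber_eq k).symm.trans hγ) (by omega)
  obtain ⟨e'⟩ := nonempty_starlike_iso_zagrebTree (by omega) hn hι hi₀ hL h1 h2 h3
  exact ⟨e.trans e'⟩

theorem IsTree.sum_degree_le_and_eq_iff (hT : T.IsTree) {ψ : ℕ → ℝ} (hψ : StrictlySpreading ψ)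
    (h1 : ψ 1 = 0) {k s : ℕ} (hk : 1 ≤ k) (hs : 3 ≤ s) (hγ : T.distDominationNumber k = s) :
    ∑ v, ψ (T.degree v) ≤ (k * s - 1 : ℕ) * ψ 2 + ψ (Fintype.card V - k * s) ∧
    (∑ v, ψ (T.degree v) = (k * s - 1 : ℕ) * ψ 2 + ψ (Fintype.card V - k * s) ↔
      Nonempty (T ≃g zagrebTree (Fintype.card V) k s)) := by
  classical
  have hm := hT.mul_distDominationNumber_le_card_nonLeaves hk (by omega)
  rw [hγ] at hm
  have hn := hT.connected.mul_distDominationNumber_le_card_of_two_le (j := k) (by omega)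
  rw [hγ] at hn
  have hks : 0 < k * s := Nat.mul_pos hk (by omega)
  obtain ⟨hle, heq⟩ := hT.sum_degree_le hψ h1 hks hm
  refine ⟨hle, fun h => ?_, fun ⟨e⟩ => ?_⟩
  · obtain ⟨hcard, huniq⟩ := heq h
    exact hT.nonempty_iso_zagrebTree hk hs hγ hcard huniq
  · rw [← sum_zagrebTree_degree hk (by omega) hn ψ h1]
    exact Fintype.sum_equiv e.toEquiv _ _ fun v => by
      rw [← e.degree_eq v]; rfl

end Extremal

/-! ### The Zagreb indices as degree sums, and the theorem. -/

section Zagreb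

variable {V : Type*} [Fintype V] (G : SimpleGraph V) [DecidableRel G.Adj]

/-- Each vertex contributes its degree once for every incident edge. -/
theorem zagrebPiTwo_eq_prod_pow [DecidableEq V] :
    G.zagrebPiTwo = ∏ v, G.degree v ^ G.degree v := by
  have h1 : ∀ e ∈ G.edgeFinset, (e.map fun v => G.degree v).mul
      = ∏ v with v ∈ e, G.degree v := by
    intro e he
    induction e with
    | _ u v =>
      have huv : u ≠ v := (mem_edgeFinset.1 he : G.Adj u v).ne
      have : (Finset.univ.filter fun w => w ∈ s(u, v)) = {u, v} := by ext; simp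
      rw [this, Finset.prod_pair huv]
      rfl
  rw [zagrebPiTwo, Finset.prod_congr rfl h1,
    Finset.prod_comm' (t' := Finset.univ) (s' := fun v => G.incidenceFinset v)]
  · simp
  · intro e v
    simp [mem_incidenceFinset, incidenceSet]

/-- The factor `-2` turns the upper bound for the convex weight `-log` into a lower bound for the
index. -/
theorem log_zagrebPiOne (hpos : ∀ v, 0 < G.degree v) :
    Real.log G.zagrebPiOne = -2 * ∑ v, -Real.log (G.degree v) := by
  rw [zagrebPiOne, Nat.cast_prod, Real.log_prod, Finset.mul_sum]
  · exact Finset.sum_congr rfl fun v _ => by push_cast; rw [Real.log_pow]; push_cast; ring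
  · intro v _
    have := hpos v
    positivity

theorem log_zagrebPiTwo [DecidableEq V] (hpos : ∀ v, 0 < G.degree v) :
    Real.log G.zagrebPiTwo = ∑ v, G.degree v * Real.log (G.degree v) := by
  rw [zagrebPiTwo_eq_prod_pow, Nat.cast_prod, Real.log_prod]
  · exact Finset.sum_congr rfl fun v _ => by push_cast; rw [Real.log_pow]
  · intro v _
    have := hpos v
    positivity

end Zagreb

end SimpleGraph

theorem Nat.log_cast_le_log_cast_iff {a b : ℕ} (ha : 0 < a) (hb : 0 < b) :
    Real.log a ≤ Real.log b ↔ a ≤ b := by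
  rw [Real.log_le_log_iff (by exact_mod_cast ha) (by exact_mod_cast hb), Nat.cast_le]

theorem Nat.log_cast_eq_log_cast_iff {a b : ℕ} (ha : 0 < a) (hb : 0 < b) :
    Real.log a = Real.log b ↔ a = b := by
  rw [le_antisymm_iff, le_antisymm_iff, Nat.log_cast_le_log_cast_iff ha hb,
    Nat.log_cast_le_log_cast_iff hb ha]

theorem mainTheorem3 {V : Type*} [Fintype V] [DecidableEq V] (T : SimpleGraph V)
    [DecidableRel T.Adj] (hT : T.IsTree) (n k γ : ℕ) (hk : 1 ≤ k)
    (hn : Fintype.card V = n) (hγ : T.distDominationNumber k = γ) (hγ3 : 3 ≤ γ) :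
    (k + 1) * γ ≤ n ∧
    4 ^ (k * γ - 1) * (n - k * γ) ^ 2 ≤ T.zagrebPiOne ∧
    T.zagrebPiTwo ≤ 4 ^ (k * γ - 1) * (n - k * γ) ^ (n - k * γ) ∧
    (T.zagrebPiOne = 4 ^ (k * γ - 1) * (n - k * γ) ^ 2 ↔
      Nonempty (T ≃g SimpleGraph.zagrebTree n k γ)) ∧
    (T.zagrebPiTwo = 4 ^ (k * γ - 1) * (n - k * γ) ^ (n - k * γ) ↔
      Nonempty (T ≃g SimpleGraph.zagrebTree n k γ)) := by
  subst hn
  have hcard := hT.connected.mul_distDominationNumber_le_card_of_two_le (j := k) (by omega)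
  rw [hγ] at hcard
  have hcard' := hcard
  rw [add_mul, one_mul] at hcard'
  have hpos : ∀ v, 0 < T.degree v := hT.connected.one_le_degree (by omega)
  have hψ₁ : StrictlySpreading fun d => -Real.log d :=
    .of_strictConvexOn (f := fun x => -Real.log x) strictConcaveOn_log_Ioi.neg
  have hψ₂ : StrictlySpreading fun d => d * Real.log d :=
    .of_strictConvexOn (f := fun x => x * Real.log x)
      (Real.strictConvexOn_mul_log.subset Set.Ioi_subset_Ici_self (convex_Ioi 0))
  obtain ⟨hle₁, heq₁⟩ := hT.sum_degree_le_and_eq_iff hψ₁ (by simp) hk hγ3 hγ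
  obtain ⟨hle₂, heq₂⟩ := hT.sum_degree_le_and_eq_iff hψ₂ (by simp) hk hγ3 hγ
  set d := Fintype.card V - k * γ
  -- Indeed `n - k * γ ≥ γ`, so the truncated subtraction is exact and logarithms can be compared.
  have hd : 0 < d := by omega
  have hd' : (d : ℝ) ≠ 0 := by positivity
  -- A vertex of degree 2 contributes 4 to either index: as `d ^ 2` to the first and as `d ^ d` to
  -- the second.
  have hlog4 : Real.log 4 = 2 * Real.log 2 := by
    rw [show (4 : ℝ) = 2 ^ 2 by norm_num, Real.log_pow]; norm_num
  have hb₁ : 0 < 4 ^ (k * γ - 1) * d ^ 2 := by positivity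
  have hb₂ : 0 < 4 ^ (k * γ - 1) * d ^ d := by positivity
  have hp₁ : 0 < T.zagrebPiOne := Finset.prod_pos fun v _ => pow_pos (hpos v) 2
  have hp₂ : 0 < T.zagrebPiTwo := by
    rw [T.zagrebPiTwo_eq_prod_pow]
    exact Finset.prod_pos fun v _ => pow_pos (hpos v) _
  have hl₁ : Real.log (4 ^ (k * γ - 1) * d ^ 2 : ℕ)
      = -2 * ((k * γ - 1 : ℕ) * -Real.log (2 : ℕ) + -Real.log d) := by
    push_cast
    rw [Real.log_mul (by positivity) (by positivity), Real.log_pow, Real.log_pow, hlog4]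
    push_cast
    ring
  have hl₂ : Real.log (4 ^ (k * γ - 1) * d ^ d : ℕ)
      = (k * γ - 1 : ℕ) * ((2 : ℕ) * Real.log (2 : ℕ)) + d * Real.log d := by
    push_cast
    rw [Real.log_mul (by positivity) (by positivity), Real.log_pow, Real.log_pow, hlog4]
  refine ⟨hcard, ?_, ?_, ?_, ?_⟩
  · rw [← Nat.log_cast_le_log_cast_iff hb₁ hp₁, hl₁, T.log_zagrebPiOne hpos]
    linarith
  · rw [← Nat.log_cast_le_log_cast_iff hp₂ hb₂, hl₂, T.log_zagrebPiTwo hpos]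
    exact hle₂
  · rw [← Nat.log_cast_eq_log_cast_iff hp₁ hb₁, hl₁, T.log_zagrebPiOne hpos, ← heq₁,
      mul_right_inj' (by norm_num)]
  · rw [← Nat.log_cast_eq_log_cast_iff hp₂ hb₂, hl₂, T.log_zagrebPiTwo hpos, ← heq₂]
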